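/- Let $G$ be a non-periodic locally nilpotent group, that is, a group that has an element of infinite order and all of whose finitely generated subgroups are nilpotent. Then the following conditions are equivalent: 1. $G$ is an FNI-group, i.e. $|N_G(H):H|<\infty$ for every non-normal subgroup $H$ of $G$. 2. $G$ is an FCI-group, i.e. $|C_G(x):\langle x\rangle|<\infty$ for every $x\in G$ such that $\langle x\rangle$ is not normal in $G$. 3. $|N_G(\langle x\rangle):\langle x\rangle|<\infty$ for every $x\in G$ such that $\langle x\rangle$ is not normal in $G$. -/

import Mathlib

/-- A group is locally nilpotent if each of its finitely generated subgroups is nilpotent. -/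
def IsLocallyNilpotentGroup (G : Type*) [Group G] : Prop :=
  ∀ K : Subgroup G, K.FG → Group.IsNilpotent K

/-- FCI-groups: `|C_G(x) : ⟨x⟩| < ∞` for every `x` such that `⟨x⟩` is not normal in `G`. -/
def IsFCIGroup (G : Type*) [Group G] : Prop :=
  ∀ x : G, ¬ (Subgroup.zpowers x).Normal →
    (Subgroup.zpowers x).IsFiniteRelIndex (Subgroup.centralizer {x})

/-- FNI-groups: `|N_G(H) : H| < ∞` for every non-normal subgroup `H` of `G`. -/
def IsFNIGroup (G : Type*) [Group G] : Prop :=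
  ∀ H : Subgroup G, ¬ H.Normal → H.IsFiniteRelIndex (Subgroup.normalizer (H : Set G))

/-- The finite normalizer-index condition for cyclic subgroups: `|N_G(⟨x⟩) : ⟨x⟩| < ∞` for every
`x` such that `⟨x⟩` is not normal in `G`. -/
def HasFiniteNormalizerIndexCyclic (G : Type*) [Group G] : Prop :=
  ∀ x : G, ¬ (Subgroup.zpowers x).Normal →
    (Subgroup.zpowers x).IsFiniteRelIndex
      (Subgroup.normalizer (Subgroup.zpowers x : Set G))

/-! Only FCI ⇒ FNI needs work. In a finitely generated nilpotent group with an element of infinite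
order, the center has one too. Under FCI this forces every torsion element to generate a normal
subgroup, so a non-normal `H` contains some `h` of infinite order with `⟨h⟩` not normal. Each `x`
commutes with a positive power of `h`, so `⁅x, h⁆` is torsion; it lies in `H` if `x` normalizes `H`.
Finitely many such commutators lie in a finite normal `F ≤ H`, and `H` has index at most `|C(h) :
⟨h⟩|` in the centralizer of `h` modulo `F`. This bound does not depend on `F`, hence it bounds
`|N(H) : H|`. -/

open scoped commutatorElement

/-! ### Torsion and roots in nilpotent groups. -/

namespace Group

/-- A finitely generated nilpotent group whose center is periodic is periodic. -/
theorem isOfFinOrder_of_fg_of_center {K : Type*} [Group K] [Group.IsNilpotent K]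
    (hfg : Group.FG K) (hZ : ∀ z ∈ Subgroup.center K, IsOfFinOrder z) (k : K) :
    IsOfFinOrder k := by
  revert hfg hZ k
  refine Group.nilpotent_center_quotient_ind (P := fun K _ _ => Group.FG K →
    (∀ z ∈ Subgroup.center K, IsOfFinOrder z) → ∀ k : K, IsOfFinOrder k) K ?_ ?_
  · intro K _ _ _ _ k
    rw [Subsingleton.elim k 1]
    exact IsOfFinOrder.one
  · intro K _ _ ih hfg hZ k
    have hq : IsOfFinOrder (k : K ⧸ Subgroup.center K) := by
      refine ih inferInstance ?_ _
      intro q hq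
      obtain ⟨u, rfl⟩ := QuotientGroup.mk_surjective q
      obtain ⟨S, hS⟩ := Group.fg_iff.mp hfg
      have hcomm : ∀ s : K, ⁅u, s⁆ ∈ Subgroup.center K := by
        intro s
        rw [← QuotientGroup.eq_one_iff]
        have := Subgroup.mem_center_iff.mp hq (s : K ⧸ Subgroup.center K)
        change ⁅(u : K ⧸ Subgroup.center K), (s : K ⧸ Subgroup.center K)⁆ = 1
        rw [commutatorElement_eq_one_iff_mul_comm, this]
      -- As `⁅u, s⁆` is central, each conjugation by `u` contributes one more factor `⁅u, s⁆`.
      have hpow : ∀ (s : K) (m : ℕ), u ^ m * s * (u ^ m)⁻¹ = ⁅u, s⁆ ^ m * s := by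
        intro s m
        induction m with
        | zero => simp
        | succ m ihm =>
          have hc := Subgroup.mem_center_iff.mp (pow_mem (hcomm s) m) u
          calc u ^ (m + 1) * s * (u ^ (m + 1))⁻¹
              = u * (u ^ m * s * (u ^ m)⁻¹) * u⁻¹ := by rw [pow_succ']; group
            _ = u * ⁅u, s⁆ ^ m * s * u⁻¹ := by rw [ihm]; group
            _ = ⁅u, s⁆ ^ (m + 1) * s := by
              rw [hc, pow_succ]
              nth_rw 3 [commutatorElement_def]
              group
      have hex : ∃ m : ℕ, 0 < m ∧ ∀ s ∈ S, ⁅u, s⁆ ^ m = 1 := by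
        refine ⟨∏ s ∈ hS.2.toFinset, orderOf ⁅u, s⁆, ?_, ?_⟩
        · exact Finset.prod_pos fun s _ => (hZ _ (hcomm s)).orderOf_pos
        · intro s hs
          exact orderOf_dvd_iff_pow_eq_one.mp
            (Finset.dvd_prod_of_mem (fun s => orderOf ⁅u, s⁆) (hS.2.mem_toFinset.mpr hs))
      obtain ⟨m, hm, hmS⟩ := hex
      have hcent : u ^ m ∈ Subgroup.center K := by
        have hle : Subgroup.closure S ≤ Subgroup.centralizer {u ^ m} := by
          rw [Subgroup.closure_le]
          intro s hs
          have := hpow s m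
          rw [hmS s hs, one_mul, mul_inv_eq_iff_eq_mul] at this
          exact Subgroup.mem_centralizer_singleton_iff.mpr this.symm
        rw [Subgroup.mem_center_iff]
        intro g
        have hg : g ∈ Subgroup.closure S := hS.1 ▸ Subgroup.mem_top g
        exact Subgroup.mem_centralizer_singleton_iff.mp (hle hg)
      rw [isOfFinOrder_iff_pow_eq_one]
      exact ⟨m, hm, by rw [← QuotientGroup.mk_pow, QuotientGroup.eq_one_iff]; exact hcent⟩
    obtain ⟨n, hn, hkn⟩ := isOfFinOrder_iff_pow_eq_one.mp hq
    rw [← QuotientGroup.mk_pow, QuotientGroup.eq_one_iff] at hkn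
    exact (isOfFinOrder_pow.mp (hZ _ hkn)).resolve_right hn.ne'

/-- Modulo an isolated normal subgroup `T`, if a positive power of `h` commutes with an element `y`
of a term of the upper central series, then `h` itself commutes with `y`. -/
theorem commutatorElement_mem_of_commute_pow {K : Type*} [Group K] (T : Subgroup K) [T.Normal]
    (hT : ∀ (g : K) (n : ℕ), 0 < n → g ^ n ∈ T → g ∈ T) {h : K} {j : ℕ} (hj : 0 < j) (i : ℕ)
    {y : K} (hy : y ∈ Subgroup.upperCentralSeries K i) (hc : Commute (h ^ j) y) :
    ⁅y, h⁆ ∈ T := by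
  induction i generalizing y with
  | zero =>
    rw [Subgroup.upperCentralSeries_zero, Subgroup.mem_bot] at hy
    simp [hy, one_mem]
  | succ i ih =>
    have hself : Commute (h ^ j) h := (Commute.refl h).pow_left j
    have hc' : Commute (h ^ j) ⁅y, h⁆ :=
      ((hc.mul_right hself).mul_right hc.inv_right).mul_right hself.inv_right
    have h1 := ih (Subgroup.mem_upperCentralSeries_succ_iff.mp hy h) hc'
    refine hT _ j hj ?_
    have hcq : Commute ((⁅y, h⁆ : K) : K ⧸ T) (h : K ⧸ T) := by
      rw [commute_iff_eq, ← commutatorElement_eq_one_iff_mul_comm]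
      exact (QuotientGroup.eq_one_iff _).mpr h1
    -- `⁅y, h⁆ * h` is the conjugate of `h` by `y`, and `y` fixes `h ^ j`.
    have h2 : (⁅y, h⁆ * h) ^ j = h ^ j := by
      have : ⁅y, h⁆ * h = y * h * y⁻¹ := by rw [commutatorElement_def]; group
      rw [this, conj_pow, ← hc.eq, mul_inv_cancel_right]
    have h3 : ((⁅y, h⁆ : K) : K ⧸ T) ^ j * (h : K ⧸ T) ^ j = (h : K ⧸ T) ^ j := by
      rw [← hcq.mul_pow]
      exact congrArg (QuotientGroup.mk (s := T)) h2
    rw [← QuotientGroup.eq_one_iff]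
    exact mul_eq_right.mp h3

end Group

namespace IsLocallyNilpotentGroup

variable {G : Type*} [Group G]

theorem exists_commute_not_isOfFinOrder (hnil : IsLocallyNilpotentGroup G) {a : G}
    (ha : ¬ IsOfFinOrder a) (b : G) : ∃ z : G, ¬ IsOfFinOrder z ∧ Commute z a ∧ Commute z b := by
  have hK : (Subgroup.closure {a, b}).FG := (Subgroup.fg_iff _).mpr ⟨_, rfl, by simp⟩
  have haK : a ∈ Subgroup.closure {a, b} := Subgroup.subset_closure (by simp)
  have hbK : b ∈ Subgroup.closure {a, b} := Subgroup.subset_closure (by simp)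
  have := hnil _ hK
  by_contra! hcon
  refine ha ?_
  have := Group.isOfFinOrder_of_fg_of_center ((Group.fg_iff_subgroup_fg _).mpr hK) ?_ ⟨a, haK⟩
  · exact Submonoid.isOfFinOrder_coe.mpr this
  · intro z hz
    by_contra hzo
    refine hcon z (fun hz' => hzo (Submonoid.isOfFinOrder_coe.mp hz')) ?_ ?_
    · exact congrArg Subtype.val (Subgroup.mem_center_iff.mp hz ⟨a, haK⟩).symm
    · exact congrArg Subtype.val (Subgroup.mem_center_iff.mp hz ⟨b, hbK⟩).symm

end IsLocallyNilpotentGroup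

/-- The torsion elements of a group in which they all generate normal subgroups. -/
def Subgroup.torsionOfNormalZPowers {G : Type*} [Group G]
    (hT : ∀ t : G, IsOfFinOrder t → (Subgroup.zpowers t).Normal) : Subgroup G where
  carrier := {t | IsOfFinOrder t}
  one_mem' := IsOfFinOrder.one
  inv_mem' := IsOfFinOrder.inv
  mul_mem' := by
    intro t s ht hs
    have := hT t ht
    obtain ⟨n, hn, hsn⟩ := isOfFinOrder_iff_pow_eq_one.mp hs
    have hmem : (t * s) ^ n ∈ Subgroup.zpowers t := by
      rw [← QuotientGroup.eq_one_iff, QuotientGroup.mk_pow, QuotientGroup.mk_mul,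
        (QuotientGroup.eq_one_iff t).mpr (Subgroup.mem_zpowers t), one_mul, ← QuotientGroup.mk_pow,
        hsn, QuotientGroup.mk_one]
    obtain ⟨k, hk⟩ := Subgroup.mem_zpowers_iff.mp hmem
    have : IsOfFinOrder ((t * s) ^ n) := hk ▸ ht.zpow
    exact (isOfFinOrder_pow.mp this).resolve_right hn.ne'

/-! ### Index bounds modulo a finite normal subgroup. -/

namespace Subgroup

variable {G : Type*} [Group G]

theorem isOfFinOrder_commutatorElement
    (hnil : IsLocallyNilpotentGroup G)
    (hT : ∀ t : G, IsOfFinOrder t → (zpowers t).Normal) {h x : G} {j : ℕ} (hj : 0 < j)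
    (hc : Commute (h ^ j) x) : IsOfFinOrder ⁅x, h⁆ := by
  set T := torsionOfNormalZPowers hT
  have hTn : T.Normal := ⟨fun t ht g => by
    obtain ⟨k, hk⟩ := mem_zpowers_iff.mp ((hT t ht).conj_mem t (mem_zpowers t) g)
    exact hk ▸ IsOfFinOrder.zpow ht⟩
  have := hnil (closure {x, h}) ((fg_iff _).mpr ⟨_, rfl, by simp⟩)
  obtain ⟨i, hi⟩ := Group.IsNilpotent.nilpotent (closure {x, h})
  have hx : x ∈ closure {x, h} := subset_closure (by simp)
  have hh : h ∈ closure {x, h} := subset_closure (by simp)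
  exact Group.commutatorElement_mem_of_commute_pow (T.subgroupOf (closure {x, h}))
    (fun g n hn hg => (isOfFinOrder_pow.mp (show IsOfFinOrder ((g : G) ^ n) from hg)).resolve_right
      hn.ne') (h := ⟨h, hh⟩) hj i (y := ⟨x, hx⟩) (hi ▸ mem_top _) (Subtype.ext hc)

/-- The preimage of the centralizer of `h` modulo `F`. -/
def centralizerMod (F : Subgroup G) [F.Normal] (h : G) : Subgroup G :=
  (centralizer {(h : G ⧸ F)}).comap (QuotientGroup.mk' F)

theorem mem_centralizerMod {F : Subgroup G} [F.Normal] {h x : G} :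
    x ∈ centralizerMod F h ↔ ⁅x, h⁆ ∈ F := by
  rw [centralizerMod, mem_comap, mem_centralizer_singleton_iff,
    ← commutatorElement_eq_one_iff_mul_comm, ← QuotientGroup.eq_one_iff]
  rfl

/-- The map `x ↦ ⁅x, h⁆` into `F` separates the left cosets of the centralizer of `h`. -/
theorem relIndex_centralizer_centralizerMod_le_card (F : Subgroup G) [F.Normal] [Finite F] (h : G) :
    (centralizer {h}).relIndex (centralizerMod F h) ≠ 0 ∧
      (centralizer {h}).relIndex (centralizerMod F h) ≤ Nat.card F := by
  let S := centralizerMod F h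
  have key : ∀ a b : S, ⁅(a : G), h⁆ = ⁅(b : G), h⁆ ↔ a⁻¹ * b ∈ (centralizer {h}).subgroupOf S := by
    intro a b
    rw [mem_subgroupOf, mem_centralizer_singleton_iff, commutatorElement_def, commutatorElement_def,
      mul_left_inj]
    simp only [coe_mul, coe_inv]
    constructor
    · intro e
      calc (a : G)⁻¹ * b * h = (a : G)⁻¹ * (b * h * (b : G)⁻¹) * b := by group
        _ = h * ((a : G)⁻¹ * b) := by rw [← e]; group
    · intro e
      calc (a : G) * h * (a : G)⁻¹ = a * (h * ((a : G)⁻¹ * b)) * (b : G)⁻¹ := by group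
        _ = b * h * (b : G)⁻¹ := by rw [← e]; group
  let f : S ⧸ (centralizer {h}).subgroupOf S → F :=
    Quotient.lift (fun x : S => (⟨⁅(x : G), h⁆, mem_centralizerMod.mp x.2⟩ : F))
      fun a b hab => Subtype.ext ((key a b).mpr (QuotientGroup.leftRel_apply.mp hab))
  have hf : Function.Injective f := by
    intro a b
    induction a using QuotientGroup.induction_on
    induction b using QuotientGroup.induction_on
    intro hab
    exact QuotientGroup.eq.mpr ((key _ _).mp (congrArg Subtype.val hab))
  have : Finite (S ⧸ (centralizer {h}).subgroupOf S) := Finite.of_injective f hf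
  exact ⟨Nat.card_pos.ne', Nat.card_le_card_of_injective f hf⟩

/-- `⟨h⟩` meets `F` trivially, so the factor `|F|` lost in passing from `C(h)` to the centralizer
modulo `F` is regained in passing from `⟨h⟩` to `⟨h⟩F ≤ H`. -/
theorem relIndex_centralizerMod_le {H F : Subgroup G} [F.Normal] [Finite F] (hF : F ≤ H) {h : G}
    (hh : h ∈ H) (ho : ¬ IsOfFinOrder h) (hi : (zpowers h).relIndex (centralizer {h}) ≠ 0) :
    H.relIndex (centralizerMod F h) ≠ 0 ∧
      H.relIndex (centralizerMod F h) ≤ (zpowers h).relIndex (centralizer {h}) := by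
  set S := centralizerMod F h
  obtain ⟨h0, h1⟩ := relIndex_centralizer_centralizerMod_le_card F h
  have hzC : zpowers h ≤ centralizer {h} := by
    rw [zpowers_le]; exact mem_centralizer_singleton_iff.mpr rfl
  have hCS : centralizer {h} ≤ S := by
    intro x hx
    rw [mem_centralizerMod, commutatorElement_eq_one_iff_mul_comm.mpr
      (mem_centralizer_singleton_iff.mp hx)]
    exact one_mem F
  have hFS : F ≤ S := by
    intro x hx
    rw [mem_centralizerMod, commutatorElement_def, mul_assoc, mul_assoc]
    exact mul_mem hx (by simpa [mul_assoc] using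
      ‹F.Normal›.conj_mem _ (inv_mem hx) h)
  have hmul := relIndex_mul_relIndex _ _ _ hzC hCS
  have hmul' := relIndex_mul_relIndex (zpowers h) (zpowers h ⊔ F) S le_sup_left
    (sup_le (hzC.trans hCS) hFS)
  have hS0 : (zpowers h).relIndex S ≠ 0 := hmul ▸ mul_ne_zero hi h0
  rw [← hmul'] at hS0
  have hdisj : zpowers h ⊓ F = ⊥ := by
    rw [eq_bot_iff]
    rintro g ⟨hg, hgF⟩
    obtain ⟨k, rfl⟩ := mem_zpowers_iff.mp hg
    have hk : IsOfFinOrder (h ^ k) :=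
      Submonoid.isOfFinOrder_coe.mpr (isOfFinOrder_of_finite (⟨h ^ k, hgF⟩ : F))
    obtain ⟨n, hn, hkn⟩ := isOfFinOrder_iff_pow_eq_one.mp hk
    have hz : h ^ (k * n) = h ^ (0 : ℤ) := by rw [zpow_mul, zpow_natCast, hkn, zpow_zero]
    have hkn0 := injective_zpow_iff_not_isOfFinOrder.mpr ho hz
    have hk0 : k = 0 := (mul_eq_zero.mp hkn0).resolve_right (by exact_mod_cast hn.ne')
    simp [hk0]
  have hcard : Nat.card F ≤ (zpowers h).relIndex (zpowers h ⊔ F) := by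
    rw [← relIndex_bot_left F, ← hdisj, inf_relIndex_right]
    exact relIndex_le_of_le_right le_sup_right (left_ne_zero_of_mul hS0)
  have hle : (zpowers h ⊔ F).relIndex S ≤ (zpowers h).relIndex (centralizer {h}) := by
    refine Nat.le_of_mul_le_mul_left ?_ (Nat.card_pos (α := F))
    calc Nat.card F * (zpowers h ⊔ F).relIndex S
        ≤ (zpowers h).relIndex (zpowers h ⊔ F) * (zpowers h ⊔ F).relIndex S := by gcongr
      _ = (zpowers h).relIndex (centralizer {h}) * (centralizer {h}).relIndex S := by
        rw [hmul', hmul]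
      _ ≤ Nat.card F * (zpowers h).relIndex (centralizer {h}) := by
        rw [mul_comm]; gcongr
  have hH : zpowers h ⊔ F ≤ H := sup_le (zpowers_le.mpr hh) hF
  have hne := right_ne_zero_of_mul hS0
  exact ⟨fun e => hne (relIndex_eq_zero_of_le_left hH e),
    (relIndex_le_of_le_left hH hne).trans hle⟩

/-- Finitely many torsion elements of `H` generating normal subgroups lie in a finite normal
subgroup contained in `H`. -/
theorem exists_finite_normal_of_isOfFinOrder
    (hT : ∀ t : G, IsOfFinOrder t → (zpowers t).Normal) (H : Subgroup G) (s : Finset G)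
    (hs : ∀ t ∈ s, IsOfFinOrder t ∧ t ∈ H) :
    ∃ F : Subgroup G, F.Normal ∧ Finite F ∧ F ≤ H ∧ ∀ t ∈ s, t ∈ F := by
  classical
  induction s using Finset.induction_on with
  | empty => exact ⟨⊥, inferInstance, inferInstance, bot_le, by simp⟩
  | insert a s _ ih =>
    obtain ⟨F, hn, hf, hle, hm⟩ := ih fun t ht => hs t (Finset.mem_insert_of_mem ht)
    obtain ⟨ha, haH⟩ := hs a (Finset.mem_insert_self a s)
    have := hT a ha
    have hfin : Set.Finite (zpowers a : Set G) := finite_zpowers.mpr ha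
    refine ⟨zpowers a ⊔ F, inferInstance, ?_, sup_le (zpowers_le.mpr haH) hle, ?_⟩
    · have : ((zpowers a ⊔ F : Subgroup G) : Set G).Finite := by
        rw [mul_normal]
        exact hfin.mul hf
      exact this
    · intro t ht
      rcases Finset.mem_insert.mp ht with rfl | ht
      · exact mem_sup_left (mem_zpowers t)
      · exact mem_sup_right (hm t ht)

/-- If each finite subset of `N` lies in a subgroup in which `H` has index at most `n`, then `H`
has finite index in `N`. -/
theorem relIndex_ne_zero_of_forall_finset (H N : Subgroup G) (n : ℕ)
    (hS : ∀ s : Finset G, (∀ x ∈ s, x ∈ N) → ∃ S : Subgroup G, (∀ x ∈ s, x ∈ S) ∧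
      H.relIndex S ≠ 0 ∧ H.relIndex S ≤ n) : H.relIndex N ≠ 0 := by
  classical
  intro h0
  have hinf : Infinite (N ⧸ H.subgroupOf N) := by
    rcases Nat.card_eq_zero.mp h0 with h | h
    · exact (h.false (QuotientGroup.mk 1)).elim
    · exact h
  obtain ⟨q, hq⟩ := Infinite.exists_subset_card_eq (N ⧸ H.subgroupOf N) (n + 1)
  obtain ⟨S, hsS, hS0, hSn⟩ := hS (q.image fun a => ((Quotient.out a : N) : G)) (by
    intro x hx
    obtain ⟨a, -, rfl⟩ := Finset.mem_image.mp hx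
    exact (Quotient.out a).2)
  have : Finite (S ⧸ H.subgroupOf S) := Nat.finite_of_card_ne_zero hS0
  let f : q → S ⧸ H.subgroupOf S := fun a =>
    QuotientGroup.mk ⟨((Quotient.out a.1 : N) : G), hsS _ (Finset.mem_image_of_mem _ a.2)⟩
  have hf : Function.Injective f := by
    intro a b hab
    have hab' : (Quotient.out a.1)⁻¹ * Quotient.out b.1 ∈ H.subgroupOf N :=
      (QuotientGroup.eq (s := H.subgroupOf S)).mp hab
    have := QuotientGroup.eq.mpr hab'
    rw [QuotientGroup.out_eq', QuotientGroup.out_eq'] at this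
    exact Subtype.ext this
  have hcard := Nat.card_le_card_of_injective f hf
  have hq' : Nat.card q = n + 1 := by simp [hq]
  rw [hq'] at hcard
  exact absurd (hcard.trans hSn) (by omega)

end Subgroup

/-! ### From FCI to FNI. -/

namespace IsFCIGroup

variable {G : Type*} [Group G]

theorem exists_pow_mem_zpowers (hG : IsFCIGroup G) {x z : G}
    (hx : ¬ (Subgroup.zpowers x).Normal) (hz : Commute z x) :
    ∃ n : ℕ, 0 < n ∧ z ^ n ∈ Subgroup.zpowers x := by
  have := hG x hx
  obtain ⟨n, hn, -, hmem⟩ := Subgroup.exists_pow_mem_of_relIndex_ne_zero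
    (H := Subgroup.zpowers x) (K := Subgroup.centralizer {x}) Subgroup.relIndex_ne_zero
    (Subgroup.mem_centralizer_singleton_iff.mpr hz)
  exact ⟨n, hn, hmem.1⟩

theorem normal_zpowers_of_isOfFinOrder (hG : IsFCIGroup G) (hper : ¬ IsMulTorsion G)
    (hnil : IsLocallyNilpotentGroup G) (t : G) (ht : IsOfFinOrder t) :
    (Subgroup.zpowers t).Normal := by
  by_contra hn
  obtain ⟨a, ha⟩ : ∃ a : G, ¬ IsOfFinOrder a := by
    by_contra! h
    exact hper h
  obtain ⟨z, hz, -, hzt⟩ := hnil.exists_commute_not_isOfFinOrder ha t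
  obtain ⟨n, hn, hmem⟩ := hG.exists_pow_mem_zpowers hn hzt
  obtain ⟨k, hk⟩ := Subgroup.mem_zpowers_iff.mp hmem
  have : IsOfFinOrder (z ^ n) := hk ▸ ht.zpow
  exact hz ((isOfFinOrder_pow.mp this).resolve_right hn.ne')

/-- Some `z` of infinite order commutes with both `h` and `x`; by FCI a positive power of `z` is a
nontrivial power of `h`. -/
theorem exists_pow_commute (hG : IsFCIGroup G) (hnil : IsLocallyNilpotentGroup G) {h : G}
    (hh : ¬ (Subgroup.zpowers h).Normal) (ho : ¬ IsOfFinOrder h) (x : G) :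
    ∃ j : ℕ, 0 < j ∧ Commute (h ^ j) x := by
  obtain ⟨z, hz, hzh, hzx⟩ := hnil.exists_commute_not_isOfFinOrder ho x
  obtain ⟨n, hn, hmem⟩ := hG.exists_pow_mem_zpowers hh hzh
  obtain ⟨k, hk⟩ := Subgroup.mem_zpowers_iff.mp hmem
  have hcx : Commute (h ^ k) x := hk ▸ hzx.pow_left n
  refine ⟨k.natAbs, Int.natAbs_pos.mpr ?_, ?_⟩
  · rintro rfl
    exact hz (isOfFinOrder_iff_pow_eq_one.mpr ⟨n, hn, by rw [← hk, zpow_zero]⟩)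
  · rcases Int.natAbs_eq k with e | e
    · rw [e, zpow_natCast] at hcx
      exact hcx
    · rw [e, zpow_neg, zpow_natCast] at hcx
      exact Commute.inv_left_iff.mp hcx

theorem isFNIGroup (hG : IsFCIGroup G) (hper : ¬ IsMulTorsion G)
    (hnil : IsLocallyNilpotentGroup G) : IsFNIGroup G := by
  classical
  intro H hH
  have hT := hG.normal_zpowers_of_isOfFinOrder hper hnil
  obtain ⟨h, hhH, hh⟩ : ∃ h ∈ H, ¬ (Subgroup.zpowers h).Normal := by
    by_contra! hcon
    exact hH ⟨fun h hhH g => (Subgroup.zpowers_le.mpr hhH)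
      ((hcon h hhH).conj_mem h (Subgroup.mem_zpowers h) g)⟩
  have ho : ¬ IsOfFinOrder h := fun ho => hh (hT h ho)
  have hi := (hG h hh).relIndex_ne_zero
  refine ⟨Subgroup.relIndex_ne_zero_of_forall_finset _ _
    ((Subgroup.zpowers h).relIndex (Subgroup.centralizer {h})) fun s hs => ?_⟩
  obtain ⟨F, hFn, hFf, hFH, hF⟩ := Subgroup.exists_finite_normal_of_isOfFinOrder hT H
    (s.image fun x => ⁅x, h⁆) (by
      intro t ht
      obtain ⟨x, hx, rfl⟩ := Finset.mem_image.mp ht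
      obtain ⟨j, hj, hc⟩ := hG.exists_pow_commute hnil hh ho x
      exact ⟨Subgroup.isOfFinOrder_commutatorElement hnil hT hj hc,
        mul_mem ((Subgroup.mem_normalizer_iff.mp (hs x hx) h).mp hhH) (inv_mem hhH)⟩)
  exact ⟨Subgroup.centralizerMod F h,
    fun x hx => Subgroup.mem_centralizerMod.mpr (hF _ (Finset.mem_image_of_mem _ hx)),
    Subgroup.relIndex_centralizerMod_le hFH hhH ho hi⟩

end IsFCIGroup

theorem theorem3p4 (G : Type*) [Group G] (hper : ¬ IsMulTorsion G)
    (hnil : IsLocallyNilpotentGroup G) :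
    List.TFAE [IsFNIGroup G, IsFCIGroup G, HasFiniteNormalizerIndexCyclic G] := by
  tfae_have 1 → 3 := fun h x hx => h _ hx
  tfae_have 3 → 2 := fun h x hx => by
    have := h x hx
    refine Subgroup.isFiniteRelIndex_of_le_right (H := Subgroup.zpowers x)
      (L := Subgroup.normalizer (Subgroup.zpowers x : Set G)) ?_
    rw [← Subgroup.centralizer_closure, ← Subgroup.zpowers_eq_closure]
    exact Subgroup.centralizer_le_normalizer _
  tfae_have 2 → 1 := fun h => h.isFNIGroup hper hnil
  tfae_finish
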